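/- Let $n\ge 0$ be an integer, let $\omega\in\mathbb{R}^n$, and let $M\subset\mathbb{R}^{2n}$ be an open set containing the origin, with coordinates $z=(q,p)=(q_1,\dots,q_n,p_1,\dots,p_n)$ and the Poisson bracket $\{F,G\}=\sum_{j=1}^n\left(\frac{\partial F}{\partial q_j}\frac{\partial G}{\partial p_j}-\frac{\partial F}{\partial p_j}\frac{\partial G}{\partial q_j}\right)$. Put $I_j(q,p)=\frac{p_j^2+q_j^2}{2}$ and $H_0=\sum_{j=1}^n\omega_j I_j$. Let $H=H_0+P$ with $P\in C^\infty(M,\mathbb{R})$ and $P(z)=O(\|z\|^3)$ as $z\to 0$, and let $r\ge 3$ be an integer. Then there are open neighborhoods $\mathcal U,\mathcal V\subset M$ of the origin, a real analytic canonical transformation $\tau:\mathcal U\to\mathcal V$ (a bijection that is real analytic together with its inverse and satisfies $\{F,G\}\circ\tau=\{F\circ\tau,G\circ\tau\}$ on $\mathcal U$ for all $F,G\in C^\infty(\mathcal V,\mathbb{R})$), a real polynomial $Z$ in $(q,p)$ and a function $R\in C^\infty(M,\mathbb{R})$ such that $$H\circ\tau=H_0+Z+R\quad\text{on }\mathcal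 U,$$ and (i) $Z$ has degree at most $r$ and is in normal form: $\{Z,H_0\}=0$; (ii) $R(z)=O(\|z\|^{r+1})$ as $z\to 0$; (iii) $\tau(z)=z+O(\|z\|^2)$ as $z\to 0$; (iv) if $\omega$ is non-resonant up to order $r$, that is, $\sum_{j=1}^n k_j\omega_j\ne 0$ for all $k\in\mathbb{Z}^n$ with $0<|k_1|+\dots+|k_n|\le r$, then $Z$ depends only on the actions: $Z=W(I_1,\dots,I_n)$ for a real polynomial $W$ in $n$ variables. -/

import Mathlib

open scoped Topology Asymptotics

noncomputable section

namespace Birkhoff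

/-- The phase space `ℝ^{2n}`: for `z = (q, p)` we have `q_j = z (Sum.inl j)` and
`p_j = z (Sum.inr j)`. -/
abbrev Phase (n : ℕ) : Type := EuclideanSpace ℝ (Fin n ⊕ Fin n)

/-- The partial derivative of `F` in the coordinate `i`, at the point `z`. -/
def partialDeriv {n : ℕ} (i : Fin n ⊕ Fin n) (F : Phase n → ℝ) (z : Phase n) : ℝ :=
  fderiv ℝ F z (EuclideanSpace.single i 1)

/-- The Poisson bracket
`{F, G} = ∑ j, (∂F/∂q_j * ∂G/∂p_j - ∂F/∂p_j * ∂G/∂q_j)`. -/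
def poissonBracket {n : ℕ} (F G : Phase n → ℝ) (z : Phase n) : ℝ :=
  ∑ j : Fin n,
    (partialDeriv (Sum.inl j) F z * partialDeriv (Sum.inr j) G z -
      partialDeriv (Sum.inr j) F z * partialDeriv (Sum.inl j) G z)

/-- The action `I_j(q, p) = (p_j² + q_j²) / 2`. -/
def action {n : ℕ} (j : Fin n) (z : Phase n) : ℝ :=
  (z (Sum.inr j) ^ 2 + z (Sum.inl j) ^ 2) / 2

/-- The harmonic oscillator `H₀ = ∑ j, ω_j I_j`. -/
def harmonicOscillator {n : ℕ} (ω : Fin n → ℝ) (z : Phase n) : ℝ :=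
  ∑ j : Fin n, ω j * action j z

/-- `ω` is non-resonant up to order `r`: `k · ω ≠ 0` for every integer vector `k` with
`0 < |k₁| + ⋯ + |kₙ| ≤ r`. -/
def NonResonantUpTo {n : ℕ} (ω : Fin n → ℝ) (r : ℕ) : Prop :=
  ∀ k : Fin n → ℤ, 0 < ∑ j, |k j| → ∑ j, |k j| ≤ (r : ℤ) → ∑ j, (k j : ℝ) * ω j ≠ 0

/-- The function on phase space given by a real polynomial in the `2n` coordinates. -/
def polyFun {n : ℕ} (Z : MvPolynomial (Fin n ⊕ Fin n) ℝ) (z : Phase n) : ℝ :=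
  MvPolynomial.eval (fun i => z i) Z

/-- A bijection `τ` from the open set `τ.source` onto the open set `τ.target` is a real analytic
canonical transformation if `τ` and its inverse are real analytic and `τ` preserves the Poisson
bracket of smooth functions. -/
structure IsAnalyticCanonical {n : ℕ} (τ : OpenPartialHomeomorph (Phase n) (Phase n)) :
    Prop where
  analytic : AnalyticOnNhd ℝ τ τ.source
  analytic_symm : AnalyticOnNhd ℝ τ.symm τ.target
  bracket : ∀ F G : Phase n → ℝ,
    ContDiffOn ℝ ((⊤ : ℕ∞) : WithTop ℕ∞) F τ.target →
    ContDiffOn ℝ ((⊤ : ℕ∞) : WithTop ℕ∞) G τ.target →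
    ∀ z ∈ τ.source, poissonBracket F G (τ z) = poissonBracket (F ∘ τ) (G ∘ τ) z

end Birkhoff

end

/-!
The transformation can be taken to be a polynomial automorphism of phase space. If `ℓ` is a linear
form, the Hamiltonian flow of `c ℓ ^ m` preserves `ℓ`, hence is affine in time, and its time-one map
is a polynomial symplectic shear. Powers of linear forms span all homogeneous polynomials, so for
every homogeneous `χ` of degree `k + 3` a composition of shears agrees with the identity plus
`{χ, ·}` up to terms of higher order. It takes the place of the flow of `χ`, which need not be
polynomial.

Conjugating by such a map changes the part of degree `k + 3` of the Hamiltonian by `{χ, H₀}`. In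
the complex coordinates `q_j ± i p_j` the derivation `{H₀, ·}` is diagonal with eigenvalue
`i ∑ j, ω_j (a_j - b_j)` on the monomial with exponents `(a, b)`, so this part can be reduced, one
degree after another, to the kernel of `{H₀, ·}`. If `ω` is non-resonant, then the kernel is
spanned in low degrees by the monomials with `a = b`, which are products of actions. The smooth
perturbation `P` is treated by normalizing its Taylor polynomial at the origin.
-/

noncomputable section

namespace Birkhoff

open MvPolynomial

section Order

variable {σ R : Type*}

section Semiring

variable [CommSemiring R]

theorem mul_mem_pow_of_eq {S : Type*} [CommSemiring S] {I : Ideal S} {a b : S} {j k m : ℕ}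
    (ha : a ∈ I ^ j) (hb : b ∈ I ^ k) (h : j + k = m) : a * b ∈ I ^ m :=
  h ▸ pow_add I j k ▸ Ideal.mul_mem_mul ha hb

theorem mem_pow_idealOfVars_of_isHomogeneous {p : MvPolynomial σ R} {k : ℕ}
    (hp : p.IsHomogeneous k) : p ∈ idealOfVars σ R ^ k := by
  rw [mem_pow_idealOfVars_iff']
  exact fun m hm => hp.coeff_eq_zero hm.ne

theorem X_mem_idealOfVars_pow_one (i : σ) : (X i : MvPolynomial σ R) ∈ idealOfVars σ R ^ 1 :=
  mem_pow_idealOfVars_of_isHomogeneous (isHomogeneous_X R i)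

theorem pderiv_mem_pow_idealOfVars {p : MvPolynomial σ R} {k : ℕ} (i : σ)
    (hp : p ∈ idealOfVars σ R ^ (k + 1)) : pderiv i p ∈ idealOfVars σ R ^ k := by
  classical
  rw [mem_pow_idealOfVars_iff'] at hp ⊢
  intro m hm
  rw [coeff_pderiv, hp _ (by simpa using hm), zero_mul]

end Semiring

variable [CommRing R]

theorem sub_homogeneousComponent_mem {p : MvPolynomial σ R} {k : ℕ}
    (hp : p ∈ idealOfVars σ R ^ k) :
    p - homogeneousComponent k p ∈ idealOfVars σ R ^ (k + 1) := by
  rw [mem_pow_idealOfVars_iff'] at hp ⊢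
  intro m hm
  rw [coeff_sub, coeff_homogeneousComponent]
  split_ifs with h
  · exact sub_self _
  · rw [hp m (by lia), sub_zero]

/-- The linear map `E` raises the order of vanishing at the origin by at least `d`. -/
def RaisesOrder (d : ℕ) (E : MvPolynomial σ R →ₗ[R] MvPolynomial σ R) : Prop :=
  ∀ ⦃m : ℕ⦄ ⦃p⦄, p ∈ idealOfVars σ R ^ m → E p ∈ idealOfVars σ R ^ (m + d)

theorem RaisesOrder.of_mul_X {d : ℕ} {E : MvPolynomial σ R →ₗ[R] MvPolynomial σ R}
    (hC : ∀ a, E (C a) ∈ idealOfVars σ R ^ d)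
    (hX : ∀ ⦃m p⦄ i, p ∈ idealOfVars σ R ^ m → E p ∈ idealOfVars σ R ^ (m + d) →
      E (p * X i) ∈ idealOfVars σ R ^ (m + 1 + d)) :
    RaisesOrder d E := by
  have h_monomial : ∀ k (s : σ →₀ ℕ) a, s.degree = k →
      E (monomial s a) ∈ idealOfVars σ R ^ (k + d) := by
    intro k
    induction k with
    | zero =>
      intro s a hs
      rw [(Finsupp.degree_eq_zero_iff s).1 hs, zero_add]
      exact hC a
    | succ k ih =>
      intro s a hs
      obtain ⟨i, hi⟩ : ∃ i, s i ≠ 0 := DFunLike.ne_iff.1 fun h : s = 0 => by simp [h] at hs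
      obtain ⟨s, rfl⟩ : ∃ t, s = t + Finsupp.single i 1 :=
        ⟨_, (Finsupp.sub_add_single_one_cancel hi).symm⟩
      have hs' : s.degree = k := by simpa using hs
      rw [monomial_add_single, pow_one]
      exact hX i (mem_pow_idealOfVars_of_isHomogeneous (isHomogeneous_monomial a hs')) (ih s a hs')
  intro m p hp
  rw [p.as_sum, map_sum]
  exact sum_mem fun s hs => Ideal.pow_le_pow_right
    (Nat.add_le_add_right ((mem_pow_idealOfVars_iff m p).1 hp s hs) d) (h_monomial _ s _ rfl)

theorem RaisesOrder.of_algHom {d : ℕ} {T : MvPolynomial σ R →ₐ[R] MvPolynomial σ R}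
    (hT : ∀ i, T (X i) - X i ∈ idealOfVars σ R ^ (d + 1)) :
    RaisesOrder d (T.toLinearMap - LinearMap.id) := by
  refine .of_mul_X (fun a => by simp) fun m p i hp hTp => ?_
  have h_leibniz : T (p * X i) - p * X i = (T p - p) * (T (X i) - X i) + p * (T (X i) - X i) +
      (T p - p) * X i := by
    rw [map_mul]; ring
  simp only [LinearMap.sub_apply, AlgHom.toLinearMap_apply, LinearMap.id_apply] at hTp ⊢
  rw [h_leibniz]
  have hX := X_mem_idealOfVars_pow_one (R := R) i
  exact add_mem (add_mem (Ideal.pow_le_pow_right (by lia) (mul_mem_pow_of_eq hTp (hT i) rfl))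
    (mul_mem_pow_of_eq hp (hT i) (by lia))) (mul_mem_pow_of_eq hTp hX (by lia))

theorem map_mem_pow_idealOfVars {T : MvPolynomial σ R →ₐ[R] MvPolynomial σ R}
    (hT : ∀ i, T (X i) - X i ∈ idealOfVars σ R ^ 1) {p : MvPolynomial σ R} {m : ℕ}
    (hp : p ∈ idealOfVars σ R ^ m) : T p ∈ idealOfVars σ R ^ m := by
  rw [← sub_add_cancel (T p) p]
  exact add_mem (RaisesOrder.of_algHom (d := 0) hT hp) hp

theorem algHom_X_sub_mem_pow_idealOfVars {d : ℕ}
    {T : MvPolynomial σ R →ₐ[R] MvPolynomial σ R}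
    {D : Derivation R (MvPolynomial σ R) (MvPolynomial σ R)}
    (hD : ∀ i, D (X i) ∈ idealOfVars σ R ^ (d + 1))
    (hTD : ∀ i, T (X i) - X i - D (X i) ∈ idealOfVars σ R ^ (2 * d + 1)) (i : σ) :
    T (X i) - X i ∈ idealOfVars σ R ^ (d + 1) := by
  rw [← sub_add_cancel (T (X i) - X i) (D (X i))]
  exact add_mem (Ideal.pow_le_pow_right (by lia) (hTD i)) (hD i)

theorem RaisesOrder.of_algHom_sub_derivation {d : ℕ}
    {T : MvPolynomial σ R →ₐ[R] MvPolynomial σ R}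
    {D : Derivation R (MvPolynomial σ R) (MvPolynomial σ R)}
    (hD : ∀ i, D (X i) ∈ idealOfVars σ R ^ (d + 1))
    (hTD : ∀ i, T (X i) - X i - D (X i) ∈ idealOfVars σ R ^ (2 * d + 1)) :
    RaisesOrder (2 * d) (T.toLinearMap - LinearMap.id - D.toLinearMap) := by
  have hT := algHom_X_sub_mem_pow_idealOfVars hD hTD
  refine .of_mul_X (fun a => by simp [derivation_C]) fun m p i hp hTDp => ?_
  have h_leibniz : T (p * X i) - p * X i - D (p * X i) =
      (T p - p) * (T (X i) - X i) + p * (T (X i) - X i - D (X i)) + (T p - p - D p) * X i := by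
    rw [map_mul, D.leibniz, smul_eq_mul, smul_eq_mul]; ring
  have hTp : T p - p ∈ idealOfVars σ R ^ (m + d) := RaisesOrder.of_algHom hT hp
  simp only [LinearMap.sub_apply, AlgHom.toLinearMap_apply, LinearMap.id_apply,
    Derivation.coeFn_coe] at hTDp ⊢
  rw [h_leibniz]
  have hX := X_mem_idealOfVars_pow_one (R := R) i
  exact add_mem (add_mem (mul_mem_pow_of_eq hTp (hT i) (by lia))
    (mul_mem_pow_of_eq hp (hTD i) (by lia))) (mul_mem_pow_of_eq hTDp hX (by lia))

end Order

theorem derivation_sum_apply {R A M α : Type*} [CommSemiring R] [CommSemiring A] [AddCommMonoid M]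
    [Algebra R A] [Module A M] [Module R M] (s : Finset α) (D : α → Derivation R A M) (a : A) :
    (∑ i ∈ s, D i) a = ∑ i ∈ s, D i a := by
  rw [← Derivation.coeFnAddMonoidHom_apply, map_sum, Finset.sum_apply]
  rfl

theorem derivation_apply_eq_sum_pderiv {σ R M : Type*} [Fintype σ] [CommRing R] [AddCommGroup M]
    [Module R M] [Module (MvPolynomial σ R) M] (D : Derivation R (MvPolynomial σ R) M)
    (p : MvPolynomial σ R) : D p = ∑ i, pderiv i p • D (X i) := by
  classical
  induction p using MvPolynomial.induction_on with
  | C a => simp [derivation_C]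
  | add p q hp hq => simp only [map_add, add_smul, Finset.sum_add_distrib, hp, hq]
  | mul_X p i hp =>
    simp only [Derivation.leibniz, pderiv_X, add_smul, Finset.sum_add_distrib, hp, smul_eq_mul,
      mul_smul, Finset.smul_sum, Pi.single_apply, ite_smul, one_smul, zero_smul, smul_ite,
      smul_zero, Finset.sum_ite_eq, Finset.mem_univ, if_true]

theorem derivation_comp_algHom {σ R : Type*} [CommRing R]
    {D D' : Derivation R (MvPolynomial σ R) (MvPolynomial σ R)}
    {T : MvPolynomial σ R →ₐ[R] MvPolynomial σ R}
    (h : ∀ i, D (T (X i)) = T (D' (X i))) (p : MvPolynomial σ R) : D (T p) = T (D' p) := by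
  induction p using MvPolynomial.induction_on with
  | C a => simp [algHom_C, derivation_C]
  | add p q hp hq => simp only [map_add, hp, hq]
  | mul_X p i hp => simp only [map_mul, map_add, Derivation.leibniz, smul_eq_mul, hp, h]

section Poisson

variable {ι R : Type*} [CommRing R]

/-- The Poisson bracket of polynomials in the coordinates `q_j = X (Sum.inl j)` and
`p_j = X (Sum.inr j)`. The bracket `{f, g}` is `poisson f g`, so that `poisson f` is the derivation
`{f, ·}` and `poisson` itself is the derivation with `q_j ↦ ∂/∂p_j` and `p_j ↦ -∂/∂q_j`. -/
def poisson : Derivation R (MvPolynomial (ι ⊕ ι) R)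
    (Derivation R (MvPolynomial (ι ⊕ ι) R) (MvPolynomial (ι ⊕ ι) R)) :=
  mkDerivation R (Sum.elim (fun j => pderiv (Sum.inr j)) fun j => -pderiv (Sum.inl j))

theorem exists_poisson_X_X_eq_C (i k : ι ⊕ ι) :
    ∃ c : R, poisson (X i : MvPolynomial (ι ⊕ ι) R) (X k) = C c := by
  classical
  rw [poisson, mkDerivation_X]
  rcases i with i | i
  · simp only [Sum.elim_inl, pderiv_X, Pi.single_apply]
    exact ⟨if k = Sum.inr i then 1 else 0, by split_ifs <;> simp⟩
  · simp only [Sum.elim_inr, Derivation.neg_apply, pderiv_X, Pi.single_apply]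
    exact ⟨if k = Sum.inl i then -1 else 0, by split_ifs <;> simp⟩

theorem poisson_smul_pow_X {f : MvPolynomial (ι ⊕ ι) R} {i : ι ⊕ ι} {b : R}
    (hf : poisson f (X i) = C b) (m : ℕ) (c : R) :
    poisson (c • f ^ m) (X i) = (c * m) • f ^ (m - 1) * C b := by
  rw [Derivation.map_smul, Derivation.leibniz_pow, Derivation.smul_apply, Derivation.smul_apply,
    Derivation.smul_apply, hf, smul_eq_mul, mul_smul, smul_mul_assoc, smul_mul_assoc,
    Nat.cast_smul_eq_nsmul]

theorem poisson_apply [Fintype ι] (f g : MvPolynomial (ι ⊕ ι) R) :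
    poisson f g = ∑ j, (pderiv (Sum.inl j) f * pderiv (Sum.inr j) g -
      pderiv (Sum.inr j) f * pderiv (Sum.inl j) g) := by
  rw [derivation_apply_eq_sum_pderiv poisson f, Fintype.sum_sum_type, ← Finset.sum_add_distrib,
    derivation_sum_apply]
  refine Finset.sum_congr rfl fun j _ => ?_
  simp only [poisson, mkDerivation_X, Sum.elim_inl, Sum.elim_inr, Derivation.add_apply,
    Derivation.smul_apply, Derivation.neg_apply, smul_eq_mul, mul_neg, sub_eq_add_neg]

variable [Finite ι]

theorem map_poisson {S : Type*} [CommRing S] (φ : R →+* S)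
    (f g : MvPolynomial (ι ⊕ ι) R) : map φ (poisson f g) = poisson (map φ f) (map φ g) := by
  cases nonempty_fintype ι
  simp only [poisson_apply, map_sum, map_sub, map_mul, pderiv_map]

theorem poisson_antisymm (f g : MvPolynomial (ι ⊕ ι) R) : poisson f g = -poisson g f := by
  cases nonempty_fintype ι
  rw [poisson_apply, poisson_apply, ← Finset.sum_neg_distrib]
  exact Finset.sum_congr rfl fun j _ => by ring

theorem poisson_self (f : MvPolynomial (ι ⊕ ι) R) : poisson f f = 0 := by
  cases nonempty_fintype ι
  rw [poisson_apply]
  exact Finset.sum_eq_zero fun j _ => by ring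

theorem poisson_mem_pow_idealOfVars {f g : MvPolynomial (ι ⊕ ι) R} {a b : ℕ}
    (hf : f ∈ idealOfVars _ R ^ (a + 1)) (hg : g ∈ idealOfVars _ R ^ (b + 1)) :
    poisson f g ∈ idealOfVars _ R ^ (a + b) := by
  cases nonempty_fintype ι
  rw [poisson_apply]
  exact sum_mem fun j _ => sub_mem
    (mul_mem_pow_of_eq (pderiv_mem_pow_idealOfVars _ hf) (pderiv_mem_pow_idealOfVars _ hg) rfl)
    (mul_mem_pow_of_eq (pderiv_mem_pow_idealOfVars _ hf) (pderiv_mem_pow_idealOfVars _ hg) rfl)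

theorem poisson_X_mem_pow_idealOfVars {f : MvPolynomial (ι ⊕ ι) R} {a : ℕ}
    (hf : f ∈ idealOfVars _ R ^ (a + 1)) (i : ι ⊕ ι) :
    poisson f (X i) ∈ idealOfVars _ R ^ a :=
  poisson_mem_pow_idealOfVars hf (X_mem_idealOfVars_pow_one i)

theorem isHomogeneous_poisson {f g : MvPolynomial (ι ⊕ ι) R} {a b : ℕ}
    (hf : f.IsHomogeneous (a + 1)) (hg : g.IsHomogeneous (b + 1)) :
    (poisson f g).IsHomogeneous (a + b) := by
  cases nonempty_fintype ι
  rw [poisson_apply]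
  exact .sum _ _ _ fun j _ => (hf.pderiv.mul hg.pderiv).sub (hf.pderiv.mul hg.pderiv)

variable (ι R) in
/-- The group of polynomial symplectic automorphisms, those which preserve the Poisson bracket. An
automorphism `T` is the pullback by the polynomial map with components `T (X i)`. -/
def symplecticGroup : Subgroup (MvPolynomial (ι ⊕ ι) R ≃ₐ[R] MvPolynomial (ι ⊕ ι) R) where
  carrier := {T | ∀ f g, poisson (T f) (T g) = T (poisson f g)}
  mul_mem' hS hT f g := by simp only [AlgEquiv.mul_apply, hS _ _, hT _ _]
  one_mem' f g := rfl
  inv_mem' {T} hT f g := by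
    apply T.injective
    rw [← hT]
    simp only [AlgEquiv.aut_inv, AlgEquiv.apply_symm_apply]

theorem mem_symplecticGroup_of_X {T : MvPolynomial (ι ⊕ ι) R ≃ₐ[R] MvPolynomial (ι ⊕ ι) R}
    (hT : ∀ i k, poisson (T (X i)) (T (X k)) = T (poisson (X i) (X k))) :
    T ∈ symplecticGroup ι R := by
  have h_left : ∀ i g, poisson (T (X i)) (T g) = T (poisson (X i) g) := fun i =>
    derivation_comp_algHom (T := T.toAlgHom) (hT i)
  refine fun f g => derivation_comp_algHom (T := T.toAlgHom) (fun i => ?_) g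
  change poisson (T f) (T (X i)) = T (poisson f (X i))
  rw [poisson_antisymm, h_left, poisson_antisymm f, map_neg]

end Poisson

section Shear

variable {ι R : Type*} [Fintype ι] [CommRing R]

theorem exists_poisson_linearForm_X_eq_C (a : ι ⊕ ι → R) :
    ∃ w : ι ⊕ ι → R, ∀ i, poisson (∑ k, a k • (X k : MvPolynomial (ι ⊕ ι) R)) (X i) = C (w i) := by
  choose c hc using exists_poisson_X_X_eq_C (ι := ι) (R := R)
  refine ⟨fun i => ∑ k, a k * c k i, fun i => ?_⟩
  simp only [map_sum, Derivation.map_smul, derivation_sum_apply, Derivation.smul_apply, hc, map_mul,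
    C_mul']

/-- The endomorphism `X i ↦ X i + {c ℓ ^ m, X i}`, where `ℓ` is the linear form with coefficients
`a`. It is the time-one flow of the Hamiltonian `c ℓ ^ m`, which is affine in time because `ℓ` is
a constant of the motion. -/
def shearHom (a : ι ⊕ ι → R) (m : ℕ) (c : R) :
    MvPolynomial (ι ⊕ ι) R →ₐ[R] MvPolynomial (ι ⊕ ι) R :=
  aeval fun i => X i + poisson (c • (∑ k, a k • X k) ^ m) (X i)

theorem shearHom_X (a : ι ⊕ ι → R) (m : ℕ) (c : R) (i : ι ⊕ ι) :
    shearHom a m c (X i) = X i + poisson (c • (∑ k, a k • X k) ^ m) (X i) :=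
  aeval_X _ i

theorem shearHom_linearForm (a : ι ⊕ ι → R) (m : ℕ) (c : R) :
    shearHom a m c (∑ k, a k • X k) = ∑ k, a k • X k := by
  set ℓ : MvPolynomial (ι ⊕ ι) R := ∑ k, a k • X k with hℓ
  have h_conserved : poisson (c • ℓ ^ m) ℓ = 0 := by
    simp only [Derivation.map_smul, Derivation.leibniz_pow, Derivation.smul_apply, poisson_self,
      smul_zero]
  calc shearHom a m c ℓ = ℓ + poisson (c • ℓ ^ m) ℓ := by
        simp only [hℓ, map_sum, map_smul, Derivation.map_smul, shearHom_X, smul_add,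
          Finset.sum_add_distrib]
    _ = ℓ := by rw [h_conserved, add_zero]

theorem shearHom_poisson_X (a : ι ⊕ ι → R) (m : ℕ) (c d : R) (i : ι ⊕ ι) :
    shearHom a m c (poisson (d • (∑ k, a k • X k) ^ m) (X i)) =
      poisson (d • (∑ k, a k • X k) ^ m) (X i) := by
  obtain ⟨w, hw⟩ := exists_poisson_linearForm_X_eq_C a
  rw [poisson_smul_pow_X (hw i), map_mul, map_smul, map_pow, shearHom_linearForm, algHom_C,
    algebraMap_eq]

theorem shearHom_comp_shearHom (a : ι ⊕ ι → R) (m : ℕ) (c d : R) :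
    (shearHom a m c).comp (shearHom a m d) = shearHom a m (c + d) := by
  ext1 i
  rw [AlgHom.comp_apply, shearHom_X, map_add, shearHom_poisson_X, shearHom_X, shearHom_X, add_smul,
    map_add, Derivation.add_apply, add_assoc]

theorem shearHom_zero (a : ι ⊕ ι → R) (m : ℕ) : shearHom a m 0 = AlgHom.id R _ := by
  ext1 i
  rw [shearHom_X, zero_smul, map_zero, Derivation.zero_apply, add_zero, AlgHom.id_apply]

/-- The automorphism `shearHom a m c`, whose inverse runs the flow backwards. -/
def shear (a : ι ⊕ ι → R) (m : ℕ) (c : R) :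
    MvPolynomial (ι ⊕ ι) R ≃ₐ[R] MvPolynomial (ι ⊕ ι) R :=
  .ofAlgHom (shearHom a m c) (shearHom a m (-c))
    (by rw [shearHom_comp_shearHom, add_neg_cancel, shearHom_zero])
    (by rw [shearHom_comp_shearHom, neg_add_cancel, shearHom_zero])

theorem shear_X (a : ι ⊕ ι → R) (m : ℕ) (c : R) (i : ι ⊕ ι) :
    shear a m c (X i) = X i + poisson (c • (∑ k, a k • X k) ^ m) (X i) :=
  shearHom_X a m c i

theorem shear_mem_symplecticGroup (a : ι ⊕ ι → R) (m : ℕ) (c : R) :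
    shear a m c ∈ symplecticGroup ι R := by
  obtain ⟨w, hw⟩ := exists_poisson_linearForm_X_eq_C a
  set ℓ : MvPolynomial (ι ⊕ ι) R := ∑ k, a k • X k
  set g := (c * m) • ℓ ^ (m - 1)
  set g' := (c * m * (m - 1 : ℕ)) • ℓ ^ (m - 1 - 1)
  have h_shear_X : ∀ i, shear a m c (X i) = X i + g * C (w i) := fun i => by
    rw [shear_X, poisson_smul_pow_X (hw i)]
  have h_g_X : ∀ i, poisson g (X i) = g' * C (w i) := fun i => poisson_smul_pow_X (hw i) _ _
  have h_X_g : ∀ i, poisson (X i) g = -(g' * C (w i)) := fun i => by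
    rw [poisson_antisymm, h_g_X]
  refine mem_symplecticGroup_of_X fun i k => ?_
  obtain ⟨b, hb⟩ := exists_poisson_X_X_eq_C (R := R) i k
  rw [h_shear_X, h_shear_X, hb, ← algebraMap_eq, AlgEquiv.commutes, algebraMap_eq]
  simp only [map_add, Derivation.add_apply, Derivation.leibniz, Derivation.smul_apply,
    derivation_C, hb, h_g_X, h_X_g, poisson_self g, smul_zero, zero_add,
    smul_eq_mul]
  ring

end Shear

section PowersOfLinearForms

variable {σ : Type*}

theorem apply_monomial_eq_mul {R : Type*} [CommSemiring R] (φ : MvPolynomial σ R →ₗ[R] R)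
    (m : σ →₀ ℕ) (c : R) : φ (monomial m c) = c * φ (monomial m 1) := by
  rw [← smul_eq_mul, ← map_smul, smul_monomial, smul_eq_mul, mul_one]

variable [Fintype σ]

theorem linearForm_pow_eq_sum_monomial {R : Type*} [CommSemiring R] [DecidableEq σ]
    (a : σ → R) (s : ℕ) :
    (∑ i, a i • (X i : MvPolynomial σ R)) ^ s = ∑ m ∈ Finset.univ.finsuppAntidiag s,
      monomial m (m.multinomial * m.prod fun i e => a i ^ e : R) := by
  ext d
  rw [coeff_linearCombination_X_pow_of_fintype, coeff_sum]
  simp only [coeff_monomial, Finset.sum_ite_eq', Finset.mem_finsuppAntidiag, Finset.subset_univ,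
    and_true, Finsupp.sum_fintype d (fun _ e => e) fun _ => rfl]

variable {K : Type*} [Field K] [CharZero K]

theorem apply_monomial_eq_zero_of_apply_linearForm_pow {φ : MvPolynomial σ K →ₗ[K] K} {s : ℕ}
    (hφ : ∀ a : σ → K, φ ((∑ i, a i • X i) ^ s) = 0) {m : σ →₀ ℕ} (hm : m.degree = s) :
    φ (monomial m 1) = 0 := by
  classical
  have h_pairing : ∑ d ∈ Finset.univ.finsuppAntidiag s,
      monomial d (d.multinomial * φ (monomial d 1)) = (0 : MvPolynomial σ K) := by
    refine MvPolynomial.funext fun a => ?_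
    rw [map_zero, ← hφ a, linearForm_pow_eq_sum_monomial, map_sum, map_sum]
    refine Finset.sum_congr rfl fun d _ => ?_
    rw [eval_monomial, apply_monomial_eq_mul φ d (d.multinomial * _)]
    ring
  have h_coeff := congrArg (coeff m) h_pairing
  have hm_mem : m ∈ Finset.univ.finsuppAntidiag s := by
    rw [Finset.mem_finsuppAntidiag, ← hm, Finsupp.degree_eq_sum]
    exact ⟨rfl, Finset.subset_univ _⟩
  simp only [coeff_sum, coeff_monomial, Finset.sum_ite_eq', hm_mem, if_true, coeff_zero] at h_coeff
  exact (mul_eq_zero.1 h_coeff).resolve_left (Nat.cast_ne_zero.2 (Nat.multinomial_pos _ _).ne')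

theorem mem_span_linearForm_pow {f : MvPolynomial σ K} {s : ℕ} (hf : f.IsHomogeneous s) :
    f ∈ Submodule.span K
      (Set.range fun a : σ → K => (∑ i, a i • (X i : MvPolynomial σ K)) ^ s) := by
  by_contra h_notMem
  obtain ⟨φ, hφf, hφ⟩ := Submodule.exists_le_ker_of_notMem h_notMem
  refine hφf ?_
  rw [f.as_sum, map_sum]
  refine Finset.sum_eq_zero fun m hm => ?_
  have hm_degree : m.degree = s := by_contra fun h => mem_support_iff.1 hm (hf.coeff_eq_zero h)
  rw [apply_monomial_eq_mul, apply_monomial_eq_zero_of_apply_linearForm_pow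
    (fun a => hφ (Submodule.subset_span ⟨a, rfl⟩)) hm_degree, mul_zero]

end PowersOfLinearForms

theorem comp_X_sub_mem_pow_idealOfVars {ι R : Type*} [Finite ι] [CommRing R] {k : ℕ}
    {χ₁ χ₂ : MvPolynomial (ι ⊕ ι) R} {T₁ T₂ : MvPolynomial (ι ⊕ ι) R →ₐ[R] MvPolynomial (ι ⊕ ι) R}
    (hχ₁ : χ₁ ∈ idealOfVars _ R ^ (k + 2)) (hχ₂ : χ₂ ∈ idealOfVars _ R ^ (k + 2))
    (hT₁ : ∀ i, T₁ (X i) - X i - poisson χ₁ (X i) ∈ idealOfVars _ R ^ (2 * k + 1))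
    (hT₂ : ∀ i, T₂ (X i) - X i - poisson χ₂ (X i) ∈ idealOfVars _ R ^ (2 * k + 1)) (i : ι ⊕ ι) :
    T₁ (T₂ (X i)) - X i - poisson (χ₁ + χ₂) (X i) ∈ idealOfVars _ R ^ (2 * k + 1) := by
  have hT₁_X := algHom_X_sub_mem_pow_idealOfVars (poisson_X_mem_pow_idealOfVars hχ₁) hT₁
  have h_split : T₁ (T₂ (X i)) - X i - poisson (χ₁ + χ₂) (X i) =
      T₁ (T₂ (X i) - X i - poisson χ₂ (X i)) +
        (T₁ (poisson χ₂ (X i)) - poisson χ₂ (X i)) + (T₁ (X i) - X i - poisson χ₁ (X i)) := by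
    simp only [map_sub, map_add, Derivation.add_apply]
    ring
  have h_commutator : T₁ (poisson χ₂ (X i)) - poisson χ₂ (X i) ∈ idealOfVars _ R ^ (2 * k + 1) := by
    rw [show 2 * k + 1 = k + 1 + k by lia]
    exact RaisesOrder.of_algHom hT₁_X (poisson_X_mem_pow_idealOfVars hχ₂ i)
  rw [h_split]
  exact add_mem (add_mem (map_mem_pow_idealOfVars
    (fun i => Ideal.pow_le_pow_right (by lia) (hT₁_X i)) (hT₂ i)) h_commutator) (hT₁ i)

theorem exists_symplectic_of_generator {ι K : Type*} [Finite ι] [Field K] [CharZero K] {k : ℕ}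
    {χ : MvPolynomial (ι ⊕ ι) K} (hχ : χ.IsHomogeneous (k + 2)) :
    ∃ T ∈ symplecticGroup ι K,
      ∀ i, T (X i) - X i - poisson χ (X i) ∈ idealOfVars _ K ^ (2 * k + 1) := by
  cases nonempty_fintype ι
  have h_linearForm (a : ι ⊕ ι → K) :
      ∑ i, a i • (X i : MvPolynomial (ι ⊕ ι) K) ∈ idealOfVars _ K :=
    sum_mem fun i _ =>
      Submodule.smul_of_tower_mem _ (a i) (Ideal.subset_span (Set.mem_range_self i))
  suffices χ ∈ idealOfVars _ K ^ (k + 2) ∧ ∃ T ∈ symplecticGroup ι K,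
      ∀ i, T (X i) - X i - poisson χ (X i) ∈ idealOfVars _ K ^ (2 * k + 1) from this.2
  have hχ_span := mem_span_linearForm_pow hχ
  clear hχ
  induction hχ_span using Submodule.closure_induction with
  | zero => exact ⟨zero_mem _, 1, one_mem _, fun i => by simp⟩
  | add χ₁ χ₂ _ _ h₁ h₂ =>
    obtain ⟨hχ₁, T₁, hT₁, hT₁X⟩ := h₁
    obtain ⟨hχ₂, T₂, hT₂, hT₂X⟩ := h₂
    exact ⟨add_mem hχ₁ hχ₂, T₁ * T₂, mul_mem hT₁ hT₂, comp_X_sub_mem_pow_idealOfVars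
      (T₁ := T₁.toAlgHom) (T₂ := T₂.toAlgHom) hχ₁ hχ₂ hT₁X hT₂X⟩
  | smul_mem c f hf =>
    obtain ⟨a, rfl⟩ := hf
    exact ⟨Submodule.smul_of_tower_mem _ c (Ideal.pow_mem_pow (h_linearForm a) _),
      shear a (k + 2) c, shear_mem_symplecticGroup a _ c, fun i => by
        rw [shear_X, add_sub_cancel_left, sub_self]
        exact zero_mem _⟩

theorem totalDegree_aeval_le {σ τ R : Type*} [CommSemiring R] {g : σ → MvPolynomial τ R}
    (hg : ∀ i, (g i).totalDegree ≤ 1) (p : MvPolynomial σ R) :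
    (aeval g p).totalDegree ≤ p.totalDegree := by
  conv_lhs => rw [p.as_sum, map_sum]
  refine totalDegree_finsetSum_le fun m hm => le_trans ?_ (le_totalDegree hm)
  rw [aeval_monomial, algebraMap_eq]
  calc (C (coeff m p) * m.prod fun i e => g i ^ e).totalDegree
      ≤ (m.prod fun i e => g i ^ e).totalDegree := by
        simpa only [totalDegree_C, zero_add] using
          totalDegree_mul (C (coeff m p)) (m.prod fun i e => g i ^ e)
    _ ≤ ∑ i ∈ m.support, (g i ^ m i).totalDegree := totalDegree_finsetProd _ _
    _ ≤ ∑ i ∈ m.support, m i := Finset.sum_le_sum fun i _ =>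
        (totalDegree_pow _ _).trans (mul_le_of_le_one_right (Nat.zero_le _) (hg i))

section DiagonalDerivation

variable {σ R K : Type*} [CommSemiring R] [Field K]

/-- The derivation `∑ i, μ i X i ∂/∂X i`, for which every monomial is an eigenvector. -/
def diagonalDerivation (μ : σ → R) : Derivation R (MvPolynomial σ R) (MvPolynomial σ R) :=
  mkDerivation R fun i => μ i • X i

theorem diagonalDerivation_monomial (μ : σ → R) (m : σ →₀ ℕ) (c : R) :
    diagonalDerivation μ (monomial m c) = monomial m (Finsupp.weight μ m * c) := by
  rw [diagonalDerivation, mkDerivation_monomial, Finsupp.weight_apply, Finsupp.sum, Finsupp.sum,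
    Finset.sum_mul, map_sum, Finset.smul_sum]
  refine Finset.sum_congr rfl fun i hi => ?_
  rw [smul_eq_mul, mul_smul_comm, X, monomial_mul, smul_monomial, smul_monomial,
    Finsupp.sub_add_single_one_cancel (Finsupp.mem_support_iff.1 hi), smul_eq_mul, smul_eq_mul,
    nsmul_eq_mul]
  congr 1
  ring

theorem coeff_diagonalDerivation (μ : σ → R) (p : MvPolynomial σ R) (m : σ →₀ ℕ) :
    coeff m (diagonalDerivation μ p) = Finsupp.weight μ m * coeff m p := by
  classical
  induction p using MvPolynomial.induction_on' with
  | add p q hp hq => rw [map_add, coeff_add, hp, hq, coeff_add, mul_add]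
  | monomial d c =>
    rw [diagonalDerivation_monomial, coeff_monomial, coeff_monomial]
    split_ifs with h
    · rw [h]
    · rw [mul_zero]

theorem exists_isHomogeneous_diagonalDerivation_sub_eq_zero (μ : σ → K) {f : MvPolynomial σ K}
    {s : ℕ} (hf : f.IsHomogeneous s) : ∃ χ : MvPolynomial σ K, χ.IsHomogeneous s ∧
      diagonalDerivation μ (f - diagonalDerivation μ χ) = 0 := by
  classical
  set χ : MvPolynomial σ K :=
    ∑ m ∈ f.support, monomial m ((Finsupp.weight μ m)⁻¹ * coeff m f)
  have hχ : ∀ m, coeff m χ = (Finsupp.weight μ m)⁻¹ * coeff m f := fun m => by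
    simp only [χ, coeff_sum, coeff_monomial, Finset.sum_ite_eq', mem_support_iff, ne_eq, ite_not]
    split_ifs with h
    · rw [h, mul_zero]
    · rfl
  refine ⟨χ, fun m hm => hf fun h => hm (by rw [hχ, h, mul_zero]), ?_⟩
  ext m
  rw [coeff_diagonalDerivation, coeff_sub, coeff_diagonalDerivation, hχ, coeff_zero]
  rcases eq_or_ne (Finsupp.weight μ m) 0 with h_resonant | h_nonresonant
  · rw [h_resonant, zero_mul]
  · rw [mul_inv_cancel_left₀ h_nonresonant, sub_self, mul_zero]

end DiagonalDerivation

theorem C_inv_two_mul_two {σ K : Type*} [Field K] [NeZero (2 : K)] :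
    (C 2⁻¹ * 2 : MvPolynomial σ K) = 1 := by
  rw [← map_ofNat C 2, ← map_mul, inv_mul_cancel₀ two_ne_zero, map_one]

section HarmonicOscillator

variable {ι K : Type*} [Field K]

variable (K) in
/-- The polynomial whose value is the action `I_j`. -/
def actionPoly (j : ι) : MvPolynomial (ι ⊕ ι) K :=
  (2⁻¹ : K) • (X (Sum.inr j) ^ 2 + X (Sum.inl j) ^ 2)

theorem map_actionPoly {L : Type*} [Field L] (φ : K →+* L) (j : ι) :
    map φ (actionPoly K j) = actionPoly L j := by
  simp only [actionPoly, smul_eq_C_mul, map_mul, map_add, map_pow, map_C, map_X, map_inv₀,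
    map_ofNat]

theorem poisson_actionPoly [NeZero (2 : K)] (j : ι) (f : MvPolynomial (ι ⊕ ι) K) :
    poisson (actionPoly K j) f =
      X (Sum.inl j) * pderiv (Sum.inr j) f - X (Sum.inr j) * pderiv (Sum.inl j) f := by
  simp only [actionPoly, Derivation.map_smul, map_add, Derivation.leibniz_pow, poisson,
    mkDerivation_X, Sum.elim_inl, Sum.elim_inr, Derivation.smul_apply, Derivation.add_apply,
    Derivation.neg_apply, smul_eq_mul, nsmul_eq_mul, Nat.cast_ofNat, Nat.add_one_sub_one, pow_one]
  rw [smul_eq_C_mul]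
  linear_combination
    (X (Sum.inl j) * pderiv (Sum.inr j) f - X (Sum.inr j) * pderiv (Sum.inl j) f) *
      C_inv_two_mul_two (σ := ι ⊕ ι) (K := K)

variable [Fintype ι]

/-- The polynomial `∑ j, ω_j I_j`, whose value for real `ω` is the harmonic oscillator. -/
def oscPoly (ω : ι → K) : MvPolynomial (ι ⊕ ι) K := ∑ j, ω j • actionPoly K j

theorem map_oscPoly {L : Type*} [Field L] (φ : K →+* L) (ω : ι → K) :
    map φ (oscPoly ω) = oscPoly (φ ∘ ω) := by
  simp only [oscPoly, map_sum, smul_eq_C_mul, map_mul, map_C, map_actionPoly, Function.comp_apply]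

theorem isHomogeneous_oscPoly (ω : ι → K) : (oscPoly ω).IsHomogeneous 2 := by
  refine .sum _ _ _ fun j _ => ?_
  rw [actionPoly, smul_eq_C_mul, smul_eq_C_mul]
  exact (((isHomogeneous_X_pow _ 2).add (isHomogeneous_X_pow _ 2)).C_mul _).C_mul _

theorem poisson_oscPoly_X_inl [NeZero (2 : K)] (ω : ι → K) (j : ι) :
    poisson (oscPoly ω) (X (Sum.inl j)) = -(ω j • X (Sum.inr j)) := by
  classical
  simp [oscPoly, Derivation.map_smul, poisson_actionPoly, derivation_sum_apply, pderiv_X,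
    Pi.single_apply]

theorem poisson_oscPoly_X_inr [NeZero (2 : K)] (ω : ι → K) (j : ι) :
    poisson (oscPoly ω) (X (Sum.inr j)) = ω j • X (Sum.inl j) := by
  classical
  simp [oscPoly, Derivation.map_smul, poisson_actionPoly, derivation_sum_apply, pderiv_X,
    Pi.single_apply]

end HarmonicOscillator

section ComplexCoordinates

theorem C_I_mul_C_I {σ : Type*} : (C Complex.I * C Complex.I : MvPolynomial σ ℂ) = -1 := by
  rw [← map_mul, Complex.I_mul_I, map_neg, map_one]

variable (ι : Type*)

/-- The linear change of coordinates `q_j ↦ q_j + i p_j`, `p_j ↦ q_j - i p_j`: the images of the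
variables are the complex coordinates in which the bracket with `H₀` is diagonal. -/
def complexCoordinates : MvPolynomial (ι ⊕ ι) ℂ ≃ₐ[ℂ] MvPolynomial (ι ⊕ ι) ℂ :=
  .ofAlgHom
    (aeval (Sum.elim (fun j => X (Sum.inl j) + C Complex.I * X (Sum.inr j))
      fun j => X (Sum.inl j) - C Complex.I * X (Sum.inr j)))
    (aeval (Sum.elim (fun j => C 2⁻¹ * (X (Sum.inl j) + X (Sum.inr j)))
      fun j => C 2⁻¹ * C Complex.I * (X (Sum.inr j) - X (Sum.inl j))))
    (by
      ext1 i
      rcases i with j | j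
      · simp only [AlgHom.comp_apply, AlgHom.id_apply, aeval_X, Sum.elim_inl, Sum.elim_inr,
          map_mul, map_add, algHom_C, algebraMap_eq]
        linear_combination X (Sum.inl j) * C_inv_two_mul_two (σ := ι ⊕ ι) (K := ℂ)
      · simp only [AlgHom.comp_apply, AlgHom.id_apply, aeval_X, Sum.elim_inl, Sum.elim_inr,
          map_mul, map_sub, algHom_C, algebraMap_eq]
        linear_combination X (Sum.inr j) * C_inv_two_mul_two (σ := ι ⊕ ι) (K := ℂ) -
          2 * C 2⁻¹ * X (Sum.inr j) * C_I_mul_C_I (σ := ι ⊕ ι))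
    (by
      ext1 i
      rcases i with j | j
      · simp only [AlgHom.comp_apply, AlgHom.id_apply, aeval_X, Sum.elim_inl, Sum.elim_inr,
          map_mul, map_add, algHom_C, algebraMap_eq]
        linear_combination X (Sum.inl j) * C_inv_two_mul_two (σ := ι ⊕ ι) (K := ℂ) +
          C 2⁻¹ * (X (Sum.inr j) - X (Sum.inl j)) * C_I_mul_C_I (σ := ι ⊕ ι)
      · simp only [AlgHom.comp_apply, AlgHom.id_apply, aeval_X, Sum.elim_inl, Sum.elim_inr,
          map_mul, map_sub, algHom_C, algebraMap_eq]
        linear_combination X (Sum.inr j) * C_inv_two_mul_two (σ := ι ⊕ ι) (K := ℂ) -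
          C 2⁻¹ * (X (Sum.inr j) - X (Sum.inl j)) * C_I_mul_C_I (σ := ι ⊕ ι))

variable {ι}

theorem complexCoordinates_X_inl (j : ι) : complexCoordinates ι (X (Sum.inl j)) =
    X (Sum.inl j) + C Complex.I * X (Sum.inr j) :=
  aeval_X _ _

theorem complexCoordinates_X_inr (j : ι) : complexCoordinates ι (X (Sum.inr j)) =
    X (Sum.inl j) - C Complex.I * X (Sum.inr j) :=
  aeval_X _ _

theorem isHomogeneous_complexCoordinates {p : MvPolynomial (ι ⊕ ι) ℂ} {s : ℕ}
    (hp : p.IsHomogeneous s) : (complexCoordinates ι p).IsHomogeneous s := by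
  refine one_mul s ▸ hp.aeval _ (Sum.rec (fun j => ?_) fun j => ?_)
  · exact (isHomogeneous_X _ _).add ((isHomogeneous_X _ _).C_mul _)
  · exact (isHomogeneous_X _ _).sub ((isHomogeneous_X _ _).C_mul _)

theorem isHomogeneous_complexCoordinates_symm {p : MvPolynomial (ι ⊕ ι) ℂ} {s : ℕ}
    (hp : p.IsHomogeneous s) : ((complexCoordinates ι).symm p).IsHomogeneous s := by
  refine one_mul s ▸ hp.aeval _ (Sum.rec (fun j => ?_) fun j => ?_)
  · exact ((isHomogeneous_X _ _).add (isHomogeneous_X _ _)).C_mul _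
  · rw [Sum.elim_inr, ← map_mul]
    exact ((isHomogeneous_X _ _).sub (isHomogeneous_X _ _)).C_mul _

theorem totalDegree_complexCoordinates_symm_le (p : MvPolynomial (ι ⊕ ι) ℂ) :
    ((complexCoordinates ι).symm p).totalDegree ≤ p.totalDegree := by
  refine totalDegree_aeval_le (Sum.rec (fun j => ?_) fun j => ?_) p
  · exact (((isHomogeneous_X _ _).add (isHomogeneous_X _ _)).C_mul _).totalDegree_le
  · rw [Sum.elim_inr, ← map_mul]
    exact (((isHomogeneous_X _ _).sub (isHomogeneous_X _ _)).C_mul _).totalDegree_le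

theorem complexCoordinates_monomial_of_diagonal [Fintype ι] {m : ι ⊕ ι →₀ ℕ}
    (hm : ∀ j, m (Sum.inl j) = m (Sum.inr j)) (c : ℂ) :
    complexCoordinates ι (monomial m c) =
      C c * ∏ j, (C 2 * actionPoly ℂ j) ^ m (Sum.inl j) := by
  have h_action : ∀ j : ι, (X (Sum.inl j) + C Complex.I * X (Sum.inr j)) *
      (X (Sum.inl j) - C Complex.I * X (Sum.inr j)) = C 2 * actionPoly ℂ j := fun j => by
    rw [actionPoly, smul_eq_C_mul, map_ofNat]
    linear_combination -X (Sum.inr j) ^ 2 * C_I_mul_C_I (σ := ι ⊕ ι) -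
      (X (Sum.inr j) ^ 2 + X (Sum.inl j) ^ 2) * C_inv_two_mul_two (σ := ι ⊕ ι) (K := ℂ)
  rw [monomial_eq, Finsupp.prod_fintype _ _ fun _ => pow_zero _, Fintype.prod_sum_type,
    ← Finset.prod_mul_distrib, map_mul, map_prod]
  congr 1
  · exact (complexCoordinates ι).commutes c
  · refine Finset.prod_congr rfl fun j _ => ?_
    rw [← hm, ← mul_pow, map_pow, map_mul, complexCoordinates_X_inl, complexCoordinates_X_inr,
      h_action]

/-- The eigenvalues of `{H₀, ·}` on the complex coordinates. -/
def complexFrequency (ω : ι → ℝ) : ι ⊕ ι → ℂ :=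
  Sum.elim (fun j => Complex.I * ω j) fun j => -(Complex.I * ω j)

theorem poisson_oscPoly_complexCoordinates [Fintype ι] (ω : ι → ℝ) (p : MvPolynomial (ι ⊕ ι) ℂ) :
    poisson (map Complex.ofRealHom (oscPoly ω)) (complexCoordinates ι p) =
      complexCoordinates ι (diagonalDerivation (complexFrequency ω) p) := by
  rw [map_oscPoly]
  refine derivation_comp_algHom (T := (complexCoordinates ι).toAlgHom) (fun i => ?_) p
  rcases i with j | j
  · simp only [diagonalDerivation, complexFrequency, mkDerivation_X, AlgEquiv.toAlgHom_apply,
      map_smul, complexCoordinates_X_inl, map_add, Sum.elim_inl, ← smul_eq_C_mul,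
      Derivation.map_smul, poisson_oscPoly_X_inl, poisson_oscPoly_X_inr]
    simp only [smul_eq_C_mul, Function.comp_apply, Complex.ofRealHom_eq_coe, map_mul]
    linear_combination -C ↑(ω j) * X (Sum.inr j) * C_I_mul_C_I (σ := ι ⊕ ι)
  · simp only [diagonalDerivation, complexFrequency, mkDerivation_X, AlgEquiv.toAlgHom_apply,
      map_smul, complexCoordinates_X_inr, map_sub, Sum.elim_inr, ← smul_eq_C_mul,
      Derivation.map_smul, poisson_oscPoly_X_inl, poisson_oscPoly_X_inr]
    simp only [smul_eq_C_mul, Function.comp_apply, Complex.ofRealHom_eq_coe, map_mul, map_neg]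
    linear_combination -C ↑(ω j) * X (Sum.inr j) * C_I_mul_C_I (σ := ι ⊕ ι)

theorem weight_complexFrequency [Fintype ι] (ω : ι → ℝ) (m : ι ⊕ ι →₀ ℕ) :
    Finsupp.weight (complexFrequency ω) m =
      Complex.I * ((∑ j, ((m (Sum.inl j) : ℝ) - m (Sum.inr j)) * ω j : ℝ) : ℂ) := by
  rw [Finsupp.weight_apply,
    Finsupp.sum_fintype m (fun i c => c • complexFrequency ω i) fun _ => zero_nsmul _,
    Fintype.sum_sum_type, ← Finset.sum_add_distrib, Complex.ofReal_sum, Finset.mul_sum]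
  refine Finset.sum_congr rfl fun j _ => ?_
  simp only [complexFrequency, Sum.elim_inl, Sum.elim_inr, nsmul_eq_mul]
  push_cast
  ring

theorem NonResonantUpTo.eq_of_weight_eq_zero {n : ℕ} {ω : Fin n → ℝ} {r : ℕ}
    (hω : NonResonantUpTo ω r) {m : Fin n ⊕ Fin n →₀ ℕ} (hm : m.degree ≤ r)
    (h_weight : Finsupp.weight (complexFrequency ω) m = 0) (j : Fin n) :
    m (Sum.inl j) = m (Sum.inr j) := by
  set k : Fin n → ℤ := fun j => (m (Sum.inl j) : ℤ) - m (Sum.inr j) with hk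
  have h_resonant : ∑ j, (k j : ℝ) * ω j = 0 := by
    rw [weight_complexFrequency, mul_eq_zero_iff_left Complex.I_ne_zero,
      Complex.ofReal_eq_zero] at h_weight
    simpa only [hk, Int.cast_sub, Int.cast_natCast] using h_weight
  have h_le : ∑ j, |k j| ≤ (r : ℤ) := by
    refine le_trans ?_ (Nat.cast_le.2 hm)
    rw [Finsupp.degree_eq_sum, Fintype.sum_sum_type, ← Finset.sum_add_distrib, Nat.cast_sum]
    exact Finset.sum_le_sum fun j _ => by grind
  have h_zero : ∑ j, |k j| = 0 :=
    le_antisymm (not_lt.1 fun h_pos => hω k h_pos h_le h_resonant)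
      (Finset.sum_nonneg fun _ _ => abs_nonneg _)
  have h_abs := (Finset.sum_eq_zero_iff_of_nonneg fun _ _ => abs_nonneg _).1 h_zero j
    (Finset.mem_univ j)
  exact_mod_cast sub_eq_zero.1 (abs_eq_zero.1 h_abs)

end ComplexCoordinates

section RealParts

variable {σ : Type*}

theorem exists_eq_map_ofReal_add (g : MvPolynomial σ ℂ) : ∃ a b : MvPolynomial σ ℝ,
    g = map Complex.ofRealHom a + C Complex.I * map Complex.ofRealHom b ∧
      ∀ s, g.IsHomogeneous s → a.IsHomogeneous s := by
  classical
  set a : MvPolynomial σ ℝ := ∑ m ∈ g.support, monomial m (coeff m g).re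
  set b : MvPolynomial σ ℝ := ∑ m ∈ g.support, monomial m (coeff m g).im
  refine ⟨a, b, ?_, fun s hg => .sum _ _ _ fun m hm => isHomogeneous_monomial _ ?_⟩
  · conv_lhs => rw [g.as_sum]
    simp only [a, b, map_sum, Finset.mul_sum, ← Finset.sum_add_distrib, map_monomial,
      C_mul_monomial, ← map_add]
    refine Finset.sum_congr rfl fun m _ => congrArg _ ?_
    rw [mul_comm]
    exact (Complex.re_add_im _).symm
  · exact not_imp_comm.1 hg.coeff_eq_zero (mem_support_iff.1 hm)

theorem eq_zero_of_map_ofReal_add_eq_zero {a b : MvPolynomial σ ℝ}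
    (h : map Complex.ofRealHom a + C Complex.I * map Complex.ofRealHom b = 0) : a = 0 := by
  ext m
  simpa [coeff_map, coeff_C_mul] using congrArg (fun g => (coeff m g).re) h

end RealParts

section HomologicalEquation

variable {ι : Type*}

theorem mem_range_aeval_actionPoly_of_map {f : MvPolynomial (ι ⊕ ι) ℝ}
    (hf : map Complex.ofRealHom f ∈ (aeval (R := ℂ) (actionPoly (ι := ι) ℂ)).range) :
    f ∈ (aeval (R := ℝ) (actionPoly (ι := ι) ℝ)).range := by
  obtain ⟨W, hW⟩ := hf
  obtain ⟨a, b, h_split, -⟩ := exists_eq_map_ofReal_add W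
  refine ⟨a, (sub_eq_zero.1 (eq_zero_of_map_ofReal_add_eq_zero
    (b := -aeval (actionPoly ℝ) b) ?_)).symm⟩
  have h_map : ∀ w : MvPolynomial ι ℝ, map Complex.ofRealHom (aeval (actionPoly ℝ) w) =
      aeval (actionPoly ℂ) (map Complex.ofRealHom w) := fun w => by
    induction w using MvPolynomial.induction_on with
    | C c => simp only [algHom_C, algebraMap_eq, map_C]
    | add p q hp hq => rw [map_add, map_add, hp, hq, map_add, map_add]
    | mul_X p j hp => rw [map_mul, map_mul, hp, map_mul, map_mul, map_X, aeval_X, aeval_X,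
        map_actionPoly]
  change aeval (actionPoly ℂ) W = _ at hW
  rw [map_sub, ← hW, h_split]
  simp only [AlgHom.toRingHom_eq_coe, RingHom.coe_coe, map_neg, map_add,
    map_mul, algHom_C, algebraMap_eq, h_map]
  ring

variable [Fintype ι]

theorem exists_homological_solution (ω : ι → ℝ) {f : MvPolynomial (ι ⊕ ι) ℝ} {s : ℕ}
    (hf : f.IsHomogeneous s) : ∃ χ : MvPolynomial (ι ⊕ ι) ℝ, χ.IsHomogeneous s ∧
      poisson (oscPoly ω) (f - poisson (oscPoly ω) χ) = 0 := by
  obtain ⟨x, hx, h_diagonal⟩ := exists_isHomogeneous_diagonalDerivation_sub_eq_zero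
    (complexFrequency ω)
    (isHomogeneous_complexCoordinates_symm (hf.map Complex.ofRealHom))
  obtain ⟨a, b, h_split, ha⟩ := exists_eq_map_ofReal_add (complexCoordinates ι x)
  refine ⟨a, ha s (isHomogeneous_complexCoordinates hx), eq_zero_of_map_ofReal_add_eq_zero
    (b := -poisson (oscPoly ω) (poisson (oscPoly ω) b)) ?_⟩
  have h_complex := congrArg (complexCoordinates ι) h_diagonal
  rw [← poisson_oscPoly_complexCoordinates, map_sub, ← poisson_oscPoly_complexCoordinates,
    AlgEquiv.apply_symm_apply, h_split, map_zero] at h_complex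
  rw [← h_complex]
  simp only [map_poisson, map_sub, map_neg, map_add, ← smul_eq_C_mul, Derivation.map_smul,
    smul_neg]
  abel

theorem mem_range_aeval_actionPoly {n : ℕ} {ω : Fin n → ℝ} {r : ℕ} (hω : NonResonantUpTo ω r)
    {Z : MvPolynomial (Fin n ⊕ Fin n) ℝ} (hZ : poisson (oscPoly ω) Z = 0)
    (hr : Z.totalDegree ≤ r) : Z ∈ (aeval (R := ℝ) (actionPoly (ι := Fin n) ℝ)).range := by
  refine mem_range_aeval_actionPoly_of_map ?_
  set g := (complexCoordinates (Fin n)).symm (map Complex.ofRealHom Z) with hg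
  have h_kernel : diagonalDerivation (complexFrequency ω) g = 0 :=
    (complexCoordinates (Fin n)).injective <| by
      rw [← poisson_oscPoly_complexCoordinates, AlgEquiv.apply_symm_apply, ← map_poisson, hZ,
        map_zero, map_zero]
  have h_degree : g.totalDegree ≤ r :=
    (totalDegree_complexCoordinates_symm_le _).trans <|
      (Finset.sup_mono (support_map_subset _ _)).trans hr
  rw [← (complexCoordinates (Fin n)).apply_symm_apply (map _ Z), ← hg, g.as_sum, map_sum]
  refine sum_mem fun m hm => ?_
  have h_weight : Finsupp.weight (complexFrequency ω) m = 0 := by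
    have h_coeff := coeff_diagonalDerivation (complexFrequency ω) g m
    rw [h_kernel, coeff_zero, zero_eq_mul] at h_coeff
    exact h_coeff.resolve_right (mem_support_iff.1 hm)
  rw [complexCoordinates_monomial_of_diagonal
    (hω.eq_of_weight_eq_zero ((le_totalDegree hm).trans h_degree) h_weight)]
  refine ⟨C (coeff m g) * ∏ j, (C 2 * X j) ^ m (Sum.inl j), ?_⟩
  simp only [AlgHom.toRingHom_eq_coe, RingHom.coe_coe, map_mul, map_prod, map_pow, aeval_X,
    algHom_C, algebraMap_eq]

end HomologicalEquation

section NormalForm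

variable {ι : Type*}

theorem exists_symplectic_map_sub_poisson_mem [Finite ι] {K : Type*} [Field K] [CharZero K] {k : ℕ}
    {χ : MvPolynomial (ι ⊕ ι) K} (hχ : χ.IsHomogeneous (k + 3)) :
    ∃ T ∈ symplecticGroup ι K, (∀ i, T (X i) - X i ∈ idealOfVars _ K ^ (k + 2)) ∧
      ∀ h ∈ idealOfVars _ K ^ 2, ∀ p ∈ idealOfVars _ K ^ 3,
        T (h + p) - (h + p) - poisson χ h ∈ idealOfVars _ K ^ (k + 4) := by
  obtain ⟨T, hT, hTχ⟩ := exists_symplectic_of_generator (k := k + 1) hχ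
  have hχ_X := poisson_X_mem_pow_idealOfVars (a := k + 2) (mem_pow_idealOfVars_of_isHomogeneous hχ)
  have hT_X := algHom_X_sub_mem_pow_idealOfVars (T := T.toAlgHom) hχ_X hTχ
  refine ⟨T, hT, hT_X, fun h hh p hp => ?_⟩
  have h_quadratic : T h - h - poisson χ h ∈ idealOfVars _ K ^ (k + 4) :=
    Ideal.pow_le_pow_right (by lia)
      (RaisesOrder.of_algHom_sub_derivation (T := T.toAlgHom) hχ_X hTχ hh)
  have h_higher : T p - p ∈ idealOfVars _ K ^ (k + 4) :=
    Ideal.pow_le_pow_right (by lia) (RaisesOrder.of_algHom hT_X hp)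
  rw [map_add, show T h + T p - (h + p) - poisson χ h = T h - h - poisson χ h + (T p - p) by ring]
  exact add_mem h_quadratic h_higher

theorem exists_polynomial_normalForm [Fintype ι] (ω : ι → ℝ) {f : MvPolynomial (ι ⊕ ι) ℝ}
    (hf : f ∈ idealOfVars _ ℝ ^ 3) (k : ℕ) : ∃ T ∈ symplecticGroup ι ℝ, ∃ Z,
      (∀ i, T (X i) - X i ∈ idealOfVars _ ℝ ^ 2) ∧
      T (oscPoly ω + f) - oscPoly ω - Z ∈ idealOfVars _ ℝ ^ (k + 3) ∧
      Z ∈ idealOfVars _ ℝ ^ 3 ∧ Z.totalDegree ≤ k + 2 ∧ poisson (oscPoly ω) Z = 0 := by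
  induction k with
  | zero =>
    exact ⟨1, one_mem _, 0, fun i => by simp, by simpa using hf, zero_mem _, by simp, map_zero _⟩
  | succ k ih =>
    obtain ⟨T, hT, Z, hT_X, h_rest, hZ, hZ_degree, hZ_normal⟩ := ih
    set g := T (oscPoly ω + f) - oscPoly ω - Z with hg
    obtain ⟨χ, hχ, hχ_normal⟩ :=
      exists_homological_solution ω (homogeneousComponent_isHomogeneous (k + 3) g)
    set Y := homogeneousComponent (k + 3) g - poisson (oscPoly ω) χ with hY
    have hY_homogeneous : Y.IsHomogeneous (k + 3) :=
      (homogeneousComponent_isHomogeneous _ _).sub <| by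
        simpa only [Nat.add_comm 1] using
          isHomogeneous_poisson (a := 1) (b := k + 2) (isHomogeneous_oscPoly ω) hχ
    obtain ⟨S, hS, hS_X, hSχ⟩ := exists_symplectic_map_sub_poisson_mem hχ
    have hS_X_two : ∀ i, S (X i) - X i ∈ idealOfVars _ ℝ ^ 2 := fun i =>
      Ideal.pow_le_pow_right (by lia) (hS_X i)
    refine ⟨S * T, mul_mem hS hT, Z + Y, fun i => ?_, ?_, add_mem hZ ?_, ?_, ?_⟩
    · rw [← sub_add_sub_cancel _ (S (X i)), AlgEquiv.mul_apply, ← map_sub]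
      exact add_mem (map_mem_pow_idealOfVars (T := S.toAlgHom)
        (fun i => Ideal.pow_le_pow_right one_le_two (hS_X_two i)) (hT_X i)) (hS_X_two i)
    · have h_order := hSχ _ (mem_pow_idealOfVars_of_isHomogeneous (isHomogeneous_oscPoly ω)) _
        (add_mem hZ (Ideal.pow_le_pow_right (by lia) h_rest))
      convert add_mem h_order (sub_homogeneousComponent_mem h_rest) using 1
      rw [AlgEquiv.mul_apply, show T (oscPoly ω + f) = oscPoly ω + (Z + g) by rw [hg]; ring,
        poisson_antisymm χ, hY]
      ring
    · exact Ideal.pow_le_pow_right (by lia) (mem_pow_idealOfVars_of_isHomogeneous hY_homogeneous)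
    · exact (totalDegree_add _ _).trans (max_le (by lia) hY_homogeneous.totalDegree_le)
    · rw [map_add, hZ_normal, hχ_normal, add_zero]

end NormalForm

section PolynomialFunctions

variable {n : ℕ}

theorem analyticOnNhd_polyFun (p : MvPolynomial (Fin n ⊕ Fin n) ℝ) :
    AnalyticOnNhd ℝ (polyFun p) Set.univ :=
  AnalyticOnNhd.eval_continuousLinearMap'
    (fun i => (EuclideanSpace.proj i : Phase n →L[ℝ] ℝ)) p

theorem contDiff_polyFun {m : WithTop ℕ∞} (p : MvPolynomial (Fin n ⊕ Fin n) ℝ) :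
    ContDiff ℝ m (polyFun p) :=
  (analyticOnNhd_polyFun p).contDiff

theorem differentiable_polyFun (p : MvPolynomial (Fin n ⊕ Fin n) ℝ) :
    Differentiable ℝ (polyFun p) :=
  (contDiff_polyFun (m := 1) p).differentiable one_ne_zero

theorem polyFun_add (p q : MvPolynomial (Fin n ⊕ Fin n) ℝ) :
    polyFun (p + q) = polyFun p + polyFun q :=
  funext fun _ => map_add _ p q

theorem polyFun_mul (p q : MvPolynomial (Fin n ⊕ Fin n) ℝ) :
    polyFun (p * q) = polyFun p * polyFun q :=
  funext fun _ => map_mul _ p q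

theorem polyFun_X (i : Fin n ⊕ Fin n) :
    polyFun (X i) = (EuclideanSpace.proj i : Phase n →L[ℝ] ℝ) := by
  ext z
  simp [polyFun]

theorem partialDeriv_polyFun (i : Fin n ⊕ Fin n) (p : MvPolynomial (Fin n ⊕ Fin n) ℝ) :
    partialDeriv i (polyFun p) = polyFun (pderiv i p) := by
  ext z
  simp only [partialDeriv]
  induction p using MvPolynomial.induction_on with
  | C a =>
    rw [show polyFun (C a) = fun _ : Phase n => a by ext; simp [polyFun]]
    simp [polyFun]
  | add p q hp hq =>
    rw [polyFun_add, fderiv_add (differentiable_polyFun p z) (differentiable_polyFun q z),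
      _root_.add_apply, hp, hq, map_add, polyFun_add, Pi.add_apply]
  | mul_X p j hp =>
    rw [polyFun_mul, fderiv_mul (differentiable_polyFun p z) (differentiable_polyFun (X j) z),
      _root_.add_apply, _root_.smul_apply, _root_.smul_apply, hp, polyFun_X,
      ContinuousLinearMap.fderiv]
    classical
    simp [polyFun, pderiv_X, Pi.single_apply, apply_ite]

theorem poissonBracket_polyFun (p q : MvPolynomial (Fin n ⊕ Fin n) ℝ) :
    poissonBracket (polyFun p) (polyFun q) = polyFun (poisson p q) := by
  ext z
  simp [poissonBracket, partialDeriv_polyFun, poisson_apply, polyFun]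

theorem polyFun_actionPoly (j : Fin n) : polyFun (actionPoly ℝ j) = action j := by
  ext z
  simp only [polyFun, actionPoly, smul_add, map_add, smul_eval, map_pow, eval_X, action]
  ring

theorem polyFun_oscPoly (ω : Fin n → ℝ) : polyFun (oscPoly ω) = harmonicOscillator ω := by
  ext z
  simp [polyFun, oscPoly, harmonicOscillator, ← polyFun_actionPoly, smul_eval]

theorem polyFun_aeval_actionPoly (W : MvPolynomial (Fin n) ℝ) (z : Phase n) :
    polyFun (aeval (actionPoly ℝ) W) z = eval (fun j => action j z) W := by
  simp only [← polyFun_actionPoly]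
  exact DFunLike.congr_fun (comp_aeval (actionPoly ℝ) (aeval fun i => z i)) W

theorem exists_fderiv_polyFun_eq (L : Phase n →L[ℝ] ℝ) (z : Phase n) :
    ∃ p, fderiv ℝ (polyFun p) z = L := by
  refine ⟨∑ i, L (EuclideanSpace.single i 1) • X i, ?_⟩
  refine ContinuousLinearMap.coe_injective <|
    (EuclideanSpace.basisFun (Fin n ⊕ Fin n) ℝ).toBasis.ext fun i => ?_
  have h := congrFun (partialDeriv_polyFun i (∑ i, L (EuclideanSpace.single i 1) • X i)) z
  classical
  simpa [partialDeriv, polyFun, pderiv_X, Pi.single_apply, smul_eval, apply_ite,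
    derivation_sum_apply, -Fintype.sum_sum_type] using h

theorem poissonBracket_congr {F F' G G' : Phase n → ℝ} {z : Phase n}
    (hF : fderiv ℝ F z = fderiv ℝ F' z) (hG : fderiv ℝ G z = fderiv ℝ G' z) :
    poissonBracket F G z = poissonBracket F' G' z := by
  simp only [poissonBracket, partialDeriv, hF, hG]

end PolynomialFunctions

section PolynomialMaps

variable {n : ℕ}

/-- The polynomial self-map of phase space with components `T (X i)`. Pulling polynomial functions
back along it is the action of `T`, so that `polyMap` reverses the order of composition. -/
def polyMap (T : MvPolynomial (Fin n ⊕ Fin n) ℝ →ₐ[ℝ] MvPolynomial (Fin n ⊕ Fin n) ℝ)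
    (z : Phase n) : Phase n :=
  WithLp.toLp 2 fun i => polyFun (T (X i)) z

variable (T : MvPolynomial (Fin n ⊕ Fin n) ℝ →ₐ[ℝ] MvPolynomial (Fin n ⊕ Fin n) ℝ)

theorem polyFun_polyMap (p : MvPolynomial (Fin n ⊕ Fin n) ℝ) (z : Phase n) :
    polyFun p (polyMap T z) = polyFun (T p) z := by
  have h : aeval (fun i => polyMap T z i) = (aeval fun i => z i).comp T := by
    ext i
    simp [polyMap, polyFun]
  exact DFunLike.congr_fun h p

theorem polyMap_polyMap
    (S : MvPolynomial (Fin n ⊕ Fin n) ℝ →ₐ[ℝ] MvPolynomial (Fin n ⊕ Fin n) ℝ) (z : Phase n) :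
    polyMap S (polyMap T z) = polyMap (T.comp S) z := by
  ext i
  exact polyFun_polyMap T (S (X i)) z

theorem polyMap_id (z : Phase n) : polyMap (AlgHom.id ℝ _) z = z := by
  ext i
  simp [polyMap, polyFun]

theorem analyticOnNhd_polyMap : AnalyticOnNhd ℝ (polyMap T) Set.univ := fun z _ =>
  ((EuclideanSpace.equiv (Fin n ⊕ Fin n) ℝ).symm.analyticAt _).comp
    (AnalyticAt.pi fun i => analyticOnNhd_polyFun (T (X i)) z trivial)

theorem contDiff_polyMap {m : WithTop ℕ∞} : ContDiff ℝ m (polyMap T) :=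
  (analyticOnNhd_polyMap T).contDiff

variable {T} in
theorem poissonBracket_comp_polyMap (hT : ∀ p q, poisson (T p) (T q) = T (poisson p q))
    {F G : Phase n → ℝ} {z : Phase n} (hF : DifferentiableAt ℝ F (polyMap T z))
    (hG : DifferentiableAt ℝ G (polyMap T z)) :
    poissonBracket F G (polyMap T z) = poissonBracket (F ∘ polyMap T) (G ∘ polyMap T) z := by
  have fderiv_comp_polyMap {F : Phase n → ℝ} (hF : DifferentiableAt ℝ F (polyMap T z)) {p}
      (hp : fderiv ℝ (polyFun p) (polyMap T z) = fderiv ℝ F (polyMap T z)) :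
      fderiv ℝ (F ∘ polyMap T) z = fderiv ℝ (polyFun (T p)) z := by
    have hT_diff := (contDiff_polyMap (m := 1) T).differentiable (by simp) z
    rw [← funext (polyFun_polyMap T p), fderiv_comp z hF hT_diff, ← hp,
      ← fderiv_comp z (differentiable_polyFun p _) hT_diff, Function.comp_def]
  obtain ⟨p, hp⟩ := exists_fderiv_polyFun_eq (fderiv ℝ F (polyMap T z)) (polyMap T z)
  obtain ⟨q, hq⟩ := exists_fderiv_polyFun_eq (fderiv ℝ G (polyMap T z)) (polyMap T z)
  rw [poissonBracket_congr hp.symm hq.symm, poissonBracket_polyFun, polyFun_polyMap, ← hT,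
    ← poissonBracket_polyFun,
    poissonBracket_congr (fderiv_comp_polyMap hF hp) (fderiv_comp_polyMap hG hq)]

/-- The homeomorphism of phase space induced by an automorphism of the polynomial algebra. -/
def polyHomeomorph (T : MvPolynomial (Fin n ⊕ Fin n) ℝ ≃ₐ[ℝ] MvPolynomial (Fin n ⊕ Fin n) ℝ) :
    Phase n ≃ₜ Phase n where
  toFun := polyMap T
  invFun := polyMap T.symm
  left_inv z := by rw [polyMap_polyMap, AlgEquiv.comp_symm, polyMap_id]
  right_inv z := by rw [polyMap_polyMap, AlgEquiv.symm_comp, polyMap_id]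
  continuous_toFun := (contDiff_polyMap (m := 0) _).continuous
  continuous_invFun := (contDiff_polyMap (m := 0) _).continuous

theorem isAnalyticCanonical_polyHomeomorph
    {T : MvPolynomial (Fin n ⊕ Fin n) ℝ ≃ₐ[ℝ] MvPolynomial (Fin n ⊕ Fin n) ℝ}
    (hT : T ∈ symplecticGroup (Fin n) ℝ) {U : Set (Phase n)} (hU : IsOpen U) :
    IsAnalyticCanonical ((polyHomeomorph T).toOpenPartialHomeomorphOfImageEq U hU _ rfl) where
  analytic := (analyticOnNhd_polyMap T.toAlgHom).mono (Set.subset_univ _)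
  analytic_symm := (analyticOnNhd_polyMap T.symm.toAlgHom).mono (Set.subset_univ _)
  bracket F G hF hG z hz := by
    have h_target := (polyHomeomorph T).isOpenMap U hU |>.mem_nhds (Set.mem_image_of_mem _ hz)
    exact poissonBracket_comp_polyMap (T := T.toAlgHom) hT
      ((hF.contDiffAt h_target).differentiableAt (by simp))
      ((hG.contDiffAt h_target).differentiableAt (by simp))

end PolynomialMaps

section TaylorExpansion

theorem isBigO_norm_pow_of_le {E : Type*} [SeminormedAddCommGroup E] {j k : ℕ} (h : j ≤ k) :
    (fun z : E => ‖z‖ ^ k) =O[𝓝 0] fun z => ‖z‖ ^ j := by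
  refine .of_bound 1 ?_
  filter_upwards [Metric.closedBall_mem_nhds (0 : E) one_pos] with z hz
  rw [mem_closedBall_zero_iff] at hz
  simpa using pow_le_pow_of_le_one (norm_nonneg z) hz h

variable {E F : Type*} [NormedAddCommGroup E] [NormedSpace ℝ E]
  [NormedAddCommGroup F] [NormedSpace ℝ F]

theorem exists_contDiff_eventuallyEq [HasContDiffBump E] {m : ℕ∞} {f : E → F} {x : E} {U : Set E}
    (hU : IsOpen U) (hx : x ∈ U) (hf : ContDiffOn ℝ m f U) :
    ∃ g : E → F, ContDiff ℝ m g ∧ g =ᶠ[𝓝 x] f := by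
  obtain ⟨ε, hε, hεU⟩ := Metric.isOpen_iff.mp hU x hx
  let b : ContDiffBump x := ⟨ε / 4, ε / 2, by positivity, by linarith⟩
  refine ⟨fun z => b z • f z, contDiff_iff_contDiffAt.2 fun z => ?_, ?_⟩
  · by_cases hz : z ∈ Metric.ball x ε
    · exact b.contDiffAt.smul (hf.contDiffAt (hU.mem_nhds (hεU hz)))
    · refine contDiffAt_const (c := (0 : F)) |>.congr_of_eventuallyEq ?_
      have h_far : b.rOut < dist z x := (by linarith : ε / 2 < ε).trans_le (not_lt.1 hz)
      have h_dist : ContinuousAt (fun w => dist w x) z := by fun_prop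
      filter_upwards [h_dist.eventually_const_lt h_far] with w hw
      rw [b.zero_of_le_dist hw.le, zero_smul]
  · filter_upwards [b.eventuallyEq_one] with z hz
    simp [hz]

variable [CompleteSpace F]

theorem norm_map_add_sub_taylor_le {f : E → F} {x y : E} {m : ℕ} {K : ℝ}
    (hf : ∀ t ∈ Set.Icc (0 : ℝ) 1, ContDiffAt ℝ (m + 1) f (x + t • y))
    (hK : ∀ t ∈ Set.Icc (0 : ℝ) 1, ‖iteratedFDeriv ℝ (m + 1) f (x + t • y)‖ ≤ K) :
    ‖f (x + y) - ∑ k ∈ Finset.range (m + 1),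
      (k.factorial : ℝ)⁻¹ • iteratedFDeriv ℝ k f x fun _ => y‖ ≤
        (m.factorial : ℝ)⁻¹ * (K * ‖y‖ ^ (m + 1)) := by
  have h_integrand (t : ℝ) (ht : t ∈ Set.uIoc 0 1) :
      ‖(1 - t) ^ m • iteratedFDeriv ℝ (m + 1) f (x + t • y) (fun _ => y)‖ ≤ K * ‖y‖ ^ (m + 1) := by
    rw [Set.uIoc_of_le zero_le_one] at ht
    have h_weight : ‖(1 - t) ^ m‖ ≤ 1 := by
      rw [norm_pow, Real.norm_of_nonneg (sub_nonneg.2 ht.2)]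
      exact pow_le_one₀ (sub_nonneg.2 ht.2) (by linarith [ht.1])
    have h_deriv : ‖iteratedFDeriv ℝ (m + 1) f (x + t • y) (fun _ => y)‖ ≤ K * ‖y‖ ^ (m + 1) := by
      refine (ContinuousMultilinearMap.le_opNorm _ _).trans ?_
      rw [Finset.prod_const, Finset.card_univ, Fintype.card_fin]
      gcongr
      exact hK t ⟨ht.1.le, ht.2⟩
    rw [norm_smul]
    exact (mul_le_of_le_one_left (norm_nonneg _) h_weight).trans h_deriv
  rw [map_add_eq_sum_add_integral_iteratedFDeriv hf, add_sub_cancel_left, norm_smul, norm_inv,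
    Real.norm_natCast]
  gcongr
  simpa using intervalIntegral.norm_integral_le_of_norm_le_const h_integrand

theorem map_add_sub_taylor_isBigO {f : E → F} {x : E} {m : ℕ} (hf : ContDiffAt ℝ (m + 1) f x) :
    (fun y => f (x + y) - ∑ k ∈ Finset.range (m + 1),
      (k.factorial : ℝ)⁻¹ • iteratedFDeriv ℝ k f x fun _ => y) =O[𝓝 0] fun y => ‖y‖ ^ (m + 1) := by
  have h_cont : ContinuousAt (iteratedFDeriv ℝ (m + 1) f) x :=
    (hf.iteratedFDeriv_right (i := m + 1) (m := 0) (by simp)).continuousAt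
  set K := ‖iteratedFDeriv ℝ (m + 1) f x‖ + 1
  have h_near : ∀ᶠ y in 𝓝 x, ContDiffAt ℝ (m + 1) f y ∧ ‖iteratedFDeriv ℝ (m + 1) f y‖ < K :=
    (hf.eventually (by exact_mod_cast WithTop.coe_ne_top)).and
      (h_cont.norm.eventually_lt_const (lt_add_one _))
  obtain ⟨ε, hε, h_ball⟩ := Metric.eventually_nhds_iff_ball.1 h_near
  refine .of_bound ((m.factorial : ℝ)⁻¹ * K) ?_
  filter_upwards [Metric.ball_mem_nhds (0 : E) hε] with y hy
  have h_segment (t : ℝ) (ht : t ∈ Set.Icc 0 1) : x + t • y ∈ Metric.ball x ε := by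
    rw [mem_ball_zero_iff] at hy
    rw [mem_ball_iff_norm, add_sub_cancel_left, norm_smul, Real.norm_of_nonneg ht.1]
    exact (mul_le_of_le_one_left (norm_nonneg y) ht.2).trans_lt hy
  rw [norm_pow, norm_norm, mul_assoc]
  exact norm_map_add_sub_taylor_le (fun t ht => (h_ball _ (h_segment t ht)).1)
    fun t ht => (h_ball _ (h_segment t ht)).2.le

theorem iteratedFDeriv_apply_eq_zero_of_isBigO {f : E → F} {x : E} {s k : ℕ}
    (hf : ContDiffAt ℝ s f x) (hfO : (fun y => f (x + y)) =O[𝓝 0] fun y => ‖y‖ ^ s) (hk : k < s)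
    (y : E) : (iteratedFDeriv ℝ k f x fun _ => y) = 0 := by
  induction k using Nat.strong_induction_on generalizing y with
  | _ k ih =>
    have h_taylor := map_add_sub_taylor_isBigO (m := k) (hf.of_le (by exact_mod_cast hk))
    have h_leading (y : E) : ∑ j ∈ Finset.range (k + 1),
        (j.factorial : ℝ)⁻¹ • (iteratedFDeriv ℝ j f x fun _ => y) =
          (k.factorial : ℝ)⁻¹ • iteratedFDeriv ℝ k f x fun _ => y := by
      rw [Finset.sum_range_succ, Finset.sum_eq_zero, zero_add]
      intro j hj
      rw [Finset.mem_range] at hj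
      rw [ih j hj (hj.trans hk), smul_zero]
    simp only [h_leading] at h_taylor
    have h_zero := ((hfO.trans (isBigO_norm_pow_of_le hk)).sub h_taylor).congr_left
      (f₂ := fun y => ((k.factorial : ℝ)⁻¹ • iteratedFDeriv ℝ k f x) fun _ => y) fun y => by simp
    simpa [Nat.factorial_ne_zero] using h_zero.continuousMultilinearMap_apply_eq_zero y

end TaylorExpansion

section PolynomialAsymptotics

variable {n : ℕ}

theorem polyFun_isBigO {k : ℕ} {p : MvPolynomial (Fin n ⊕ Fin n) ℝ}
    (hp : p ∈ idealOfVars _ ℝ ^ k) : polyFun p =O[𝓝 0] fun z => ‖z‖ ^ k := by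
  have h_bounded (q) : polyFun (n := n) q =O[𝓝 0] fun _ => (1 : ℝ) :=
    (differentiable_polyFun q).continuous.continuousAt.isBigO_one ℝ
  have h_one : ∀ q ∈ idealOfVars (Fin n ⊕ Fin n) ℝ, polyFun q =O[𝓝 0] fun z => ‖z‖ := by
    intro q hq
    induction hq using Submodule.span_induction with
    | mem x hx =>
      obtain ⟨i, rfl⟩ := hx
      rw [polyFun_X]
      exact (ContinuousLinearMap.isBigO_id _ _).norm_right
    | zero => exact (Asymptotics.isBigO_zero _ _).congr_left fun _ => (map_zero (eval _)).symm
    | add q r _ _ hq hr => exact polyFun_add q r ▸ hq.add hr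
    | smul a q _ hq => exact polyFun_mul a q ▸ ((h_bounded a).mul hq).congr_right fun _ => one_mul _
  induction k generalizing p with
  | zero => simpa using h_bounded p
  | succ k ih =>
    rw [pow_succ] at hp
    induction hp using Submodule.mul_induction_on' with
    | mem_mul_mem a ha b hb =>
      simp only [pow_succ]
      exact polyFun_mul a b ▸ (ih ha).mul (h_one b hb)
    | add p _ q _ hp hq => exact polyFun_add p q ▸ hp.add hq

theorem exists_isHomogeneous_polyFun_eq {k : ℕ}
    (A : ContinuousMultilinearMap ℝ (fun _ : Fin k => Phase n) ℝ) :
    ∃ p, p.IsHomogeneous k ∧ ∀ z, polyFun p z = A fun _ => z := by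
  classical
  refine ⟨∑ r : Fin k → Fin n ⊕ Fin n, C (A fun i => EuclideanSpace.single (r i) (1 : ℝ)) *
    ∏ i, X (r i), .sum _ _ _ fun r _ => .C_mul ?_ _, fun z => ?_⟩
  · simpa using IsHomogeneous.prod Finset.univ _ (fun _ => 1) fun i _ => isHomogeneous_X ℝ (r i)
  · have h_basis : z = ∑ i, z i • EuclideanSpace.single i (1 : ℝ) := by
      simpa using ((EuclideanSpace.basisFun (Fin n ⊕ Fin n) ℝ).sum_repr z).symm
    conv_rhs => rw [h_basis]
    rw [A.map_sum]
    simp [polyFun, A.map_smul_univ (fun _ => z _), mul_comm]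

theorem exists_polyFun_sub_isBigO {f : Phase n → ℝ} {s m : ℕ} (hsm : s ≤ m + 1)
    (hf : ContDiffAt ℝ (m + 1) f 0) (hfO : f =O[𝓝 0] fun z => ‖z‖ ^ s) :
    ∃ p ∈ idealOfVars _ ℝ ^ s, (fun z => f z - polyFun p z) =O[𝓝 0] fun z => ‖z‖ ^ (m + 1) := by
  choose p hp_homogeneous hp using fun k =>
    exists_isHomogeneous_polyFun_eq (iteratedFDeriv ℝ k f 0)
  have hp_low (k : ℕ) (hk : k < s) (z : Phase n) : polyFun (p k) z = 0 := by
    rw [hp]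
    exact iteratedFDeriv_apply_eq_zero_of_isBigO (hf.of_le (by exact_mod_cast hsm))
      (by simpa using hfO) hk z
  refine ⟨∑ k ∈ Finset.Ico s (m + 1), C (k.factorial : ℝ)⁻¹ * p k, sum_mem fun k hk => ?_, ?_⟩
  · exact Ideal.mul_mem_left _ _ <| Ideal.pow_le_pow_right (Finset.mem_Ico.1 hk).1 <|
      mem_pow_idealOfVars_of_isHomogeneous (hp_homogeneous k)
  · refine (map_add_sub_taylor_isBigO hf).congr_left fun z => ?_
    rw [zero_add, ← Finset.sum_range_add_sum_Ico _ hsm, Finset.sum_eq_zero, zero_add]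
    · simp [polyFun, ← hp]
    · intro k hk
      rw [← hp, hp_low k (Finset.mem_range.1 hk), smul_zero]

variable {T : MvPolynomial (Fin n ⊕ Fin n) ℝ →ₐ[ℝ] MvPolynomial (Fin n ⊕ Fin n) ℝ}

theorem polyMap_sub_self_isBigO {k : ℕ} (hT : ∀ i, T (X i) - X i ∈ idealOfVars _ ℝ ^ k) :
    (fun z => polyMap T z - z) =O[𝓝 0] fun z => ‖z‖ ^ k := by
  have h_coord (i) : (fun z => (polyMap T z - z) i) =O[𝓝 0] fun z => ‖z‖ ^ k :=
    (polyFun_isBigO (hT i)).congr_left fun z => by simp [polyFun, polyMap]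
  exact ((EuclideanSpace.equiv _ ℝ).symm.toContinuousLinearMap.isBigO_comp
    (fun z => (EuclideanSpace.equiv _ ℝ) (polyMap T z - z)) _).trans
    (Asymptotics.isBigO_pi.2 h_coord)

theorem polyMap_zero (hT : ∀ i, T (X i) - X i ∈ idealOfVars _ ℝ ^ 2) : polyMap T 0 = 0 := by
  have h := Asymptotics.isBigO_pure.1 ((polyMap_sub_self_isBigO hT).mono (pure_le_nhds 0))
  simpa using h

theorem comp_polyMap_sub_isBigO {F : Phase n → ℝ} {p q : MvPolynomial (Fin n ⊕ Fin n) ℝ} {m : ℕ}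
    (hT : ∀ i, T (X i) - X i ∈ idealOfVars _ ℝ ^ 2)
    (hF : (fun z => F z - polyFun p z) =O[𝓝 0] fun z => ‖z‖ ^ m)
    (hpq : T p - q ∈ idealOfVars _ ℝ ^ m) :
    (fun z => F (polyMap T z) - polyFun q z) =O[𝓝 0] fun z => ‖z‖ ^ m := by
  have h_tendsto : Filter.Tendsto (polyMap T) (𝓝 0) (𝓝 0) := by
    simpa only [polyMap_zero hT] using (contDiff_polyMap (m := 0) T).continuous.tendsto 0
  have h_linear : polyMap T =O[𝓝 0] fun z => ‖z‖ := by
    have h := (polyMap_sub_self_isBigO hT).trans (isBigO_norm_pow_of_le one_le_two)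
    simpa using (h.congr_right fun z => pow_one _).add (Asymptotics.isBigO_refl id _).norm_right
  refine (((hF.comp_tendsto h_tendsto).trans (h_linear.norm_left.pow m)).add
    (polyFun_isBigO hpq)).congr_left fun z => ?_
  have h_sub : polyFun (T p - q) z = polyFun (T p) z - polyFun q z := map_sub (eval _) _ _
  rw [h_sub, ← polyFun_polyMap]
  simp only [Function.comp_apply]
  ring

end PolynomialAsymptotics

theorem contDiff_harmonicOscillator {n : ℕ} {m : WithTop ℕ∞} (ω : Fin n → ℝ) :
    ContDiff ℝ m (harmonicOscillator ω) :=
  polyFun_oscPoly ω ▸ contDiff_polyFun _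

theorem exists_smooth_normalForm {n : ℕ} (ω : Fin n → ℝ) {P : Phase n → ℝ} {k : ℕ}
    (hP : ContDiffAt ℝ (k + 3) P 0) (hPO : P =O[𝓝 0] fun z => ‖z‖ ^ 3) :
    ∃ T ∈ symplecticGroup (Fin n) ℝ, ∃ Z, (∀ i, T (X i) - X i ∈ idealOfVars _ ℝ ^ 2) ∧
      Z.totalDegree ≤ k + 2 ∧ poisson (oscPoly ω) Z = 0 ∧
      (fun z => harmonicOscillator ω (polyMap T z) + P (polyMap T z) -
        (harmonicOscillator ω z + polyFun Z z)) =O[𝓝 0] fun z => ‖z‖ ^ (k + 3) := by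
  obtain ⟨f, hf, hPf⟩ := exists_polyFun_sub_isBigO (m := k + 2) (by lia) hP hPO
  obtain ⟨T, hT, Z, hT_X, h_rest, -, hZ_degree, hZ_normal⟩ := exists_polynomial_normalForm ω hf k
  refine ⟨T, hT, Z, hT_X, hZ_degree, hZ_normal, ?_⟩
  have h_taylor : (fun z => harmonicOscillator ω z + P z - polyFun (oscPoly ω + f) z) =O[𝓝 0]
      fun z => ‖z‖ ^ (k + 3) :=
    hPf.congr_left fun z => by simp [polyFun_add, polyFun_oscPoly]
  rw [sub_sub] at h_rest
  simpa only [polyFun_add, polyFun_oscPoly, Pi.add_apply] using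
    comp_polyMap_sub_isBigO (T := T.toAlgHom) hT_X h_taylor h_rest

end Birkhoff

end

theorem mainTheorem6 (n : ℕ) (ω : Fin n → ℝ)
    (M : Set (Birkhoff.Phase n)) (hM : IsOpen M) (h0 : (0 : Birkhoff.Phase n) ∈ M)
    (P : Birkhoff.Phase n → ℝ) (hP : ContDiffOn ℝ ((⊤ : ℕ∞) : WithTop ℕ∞) P M)
    (hP3 : P =O[𝓝 0] fun z => ‖z‖ ^ 3)
    (r : ℕ) (hr : 3 ≤ r) :
    ∃ (τ : OpenPartialHomeomorph (Birkhoff.Phase n) (Birkhoff.Phase n))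
      (Z : MvPolynomial (Fin n ⊕ Fin n) ℝ) (R : Birkhoff.Phase n → ℝ),
      Birkhoff.IsAnalyticCanonical τ ∧
      (0 : Birkhoff.Phase n) ∈ τ.source ∧ (0 : Birkhoff.Phase n) ∈ τ.target ∧
      τ.source ⊆ M ∧ τ.target ⊆ M ∧
      (∀ z ∈ τ.source,
        Birkhoff.harmonicOscillator ω (τ z) + P (τ z) =
          Birkhoff.harmonicOscillator ω z + Birkhoff.polyFun Z z + R z) ∧
      Z.totalDegree ≤ r ∧
      (∀ z, Birkhoff.poissonBracket (Birkhoff.polyFun Z) (Birkhoff.harmonicOscillator ω) z = 0) ∧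
      ContDiffOn ℝ ((⊤ : ℕ∞) : WithTop ℕ∞) R M ∧
      (R =O[𝓝 0] fun z => ‖z‖ ^ (r + 1)) ∧
      ((fun z => τ z - z) =O[𝓝 0] fun z => ‖z‖ ^ 2) ∧
      (Birkhoff.NonResonantUpTo ω r →
        ∃ W : MvPolynomial (Fin n) ℝ, ∀ z,
          Birkhoff.polyFun Z z = MvPolynomial.eval (fun j => Birkhoff.action j z) W) := by
  open Birkhoff in
  obtain ⟨k, rfl⟩ : ∃ k, r = k + 2 := ⟨r - 2, by lia⟩
  obtain ⟨P', hP', hP'P⟩ := exists_contDiff_eventuallyEq hM h0 hP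
  obtain ⟨T, hT, Z, hT_X, hZ_degree, hZ_normal, h_remainder⟩ := exists_smooth_normalForm ω
    (mod_cast (contDiff_infty.1 hP' (k + 3)).contDiffAt) (hP3.congr' hP'P.symm .rfl) (k := k)
  have hT_zero : polyMap T.toAlgHom 0 = 0 := polyMap_zero hT_X
  have hT_smooth := contDiff_polyMap (m := (⊤ : ℕ∞)) T.toAlgHom
  have h_near : ∀ᶠ z in 𝓝 0, z ∈ M ∧ polyMap T z ∈ M ∧ P' (polyMap T z) = P (polyMap T z) := by
    have h_tendsto : Filter.Tendsto (polyMap T.toAlgHom) (𝓝 0) (𝓝 0) := by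
      simpa only [hT_zero] using hT_smooth.continuous.tendsto 0
    exact (hM.eventually_mem h0).and (h_tendsto.eventually ((hM.eventually_mem h0).and hP'P))
  obtain ⟨U, hU, hU_open, h0U⟩ := eventually_nhds_iff.1 h_near
  refine ⟨(polyHomeomorph T).toOpenPartialHomeomorphOfImageEq U hU_open _ rfl, Z, fun z =>
    harmonicOscillator ω (polyMap T z) + P' (polyMap T z) - (harmonicOscillator ω z + polyFun Z z),
    isAnalyticCanonical_polyHomeomorph hT hU_open, h0U, ⟨0, h0U, hT_zero⟩, fun z hz => (hU z hz).1,
    Set.image_subset_iff.2 fun z hz => (hU z hz).2.1, fun z hz => ?_, hZ_degree, fun z => ?_,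
    ContDiff.contDiffOn ?_, h_remainder, polyMap_sub_self_isBigO hT_X, fun hω => ?_⟩
  · exact (congrArg _ (hU z hz).2.2.symm).trans (add_sub_cancel _ _).symm
  · rw [← polyFun_oscPoly, poissonBracket_polyFun, poisson_antisymm, hZ_normal, neg_zero]
    exact map_zero _
  · exact (((contDiff_harmonicOscillator ω).comp hT_smooth).add (hP'.comp hT_smooth)).sub
      ((contDiff_harmonicOscillator ω).add (contDiff_polyFun Z))
  · obtain ⟨W, rfl⟩ := mem_range_aeval_actionPoly hω hZ_normal hZ_degree
    exact ⟨W, polyFun_aeval_actionPoly W⟩
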